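/- **Theorem 2.** Let $X_1,X_2,\ldots$ be i.i.d. real-valued random variables with distribution $F$, let $m\ge 1$, and let $h:\mathbb{R}^m\to\mathbb{R}$ be a Borel-measurable kernel that is symmetric in its arguments. Suppose that $\mathbb{E}|h(X_1,\ldots,X_m)|^{5/3}<\infty$, that $\theta:=\int_{\mathbb{R}^m}h\,dF\cdots dF=0$, and that, with $\tilde h_1(x):=\mathbb{E}\big(h(X_1,\ldots,X_m)-\theta\,\big|\,X_1=x\big)$, the i.i.d. sequence $\tilde h_1(X_1),\tilde h_1(X_2),\ldots$ is in the domain of attraction of the normal law (DAN), i.e. there are constants $A_n$ and $B_n>0$ such that $B_n^{-1}\big(\sum_{i=1}^n\tilde h_1(X_i)-A_n\big)$ converges in distribution to $N(0,1)$. Write $[n]^{-k}:=(n-k)!/n!$. Then, as $n\to\infty$, $$\Big|\,[n]^{-2m+1}\sum h(X_{i_1},X_{i_2},\ldots,X_{i_m})\,h(X_{i_1},X_{i_{m+1}},\ldots,X_{i_{2m-1}})-\frac1n\sum_{i=1}^n\tilde h_1^2(X_i)\Big|=o_P(1),$$ where the first sum is over all $(2m-1)$-tuples $(i_1,\ldots,i_{2m-1})$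 of pairwise distinct indices in $\{1,\ldots,n\}$, and $o_P(1)$ denotes a sequence that converges to $0$ in probability. -/

import Mathlib

open MeasureTheory ProbabilityTheory Filter
open scoped Nat

noncomputable section

namespace UStat

variable {Ω : Type*} [MeasurableSpace Ω]

/-- The sequence `Y 0, Y 1, …` is in the domain of attraction of the normal law (DAN): there are
constants `A n` and `B n > 0` such that `(∑_{i<n} Y i - A n) / B n` converges in distribution
to a standard normal variable. -/
def IsDAN (P : Measure Ω) [IsProbabilityMeasure P] (Y : ℕ → Ω → ℝ) : Prop :=
  ∃ A B : ℕ → ℝ, (∀ n, 0 < B n) ∧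
    TendstoInDistribution (fun (n : ℕ) (ω : Ω) => (∑ i ∈ Finset.range n, Y i ω - A n) / B n)
      atTop (id : ℝ → ℝ) (fun _ => P) (gaussianReal 0 1)

/-- The kernel `h` of `m` real arguments is symmetric. -/
def IsSymmKernel {m : ℕ} (h : (Fin m → ℝ) → ℝ) : Prop :=
  ∀ (σ : Equiv.Perm (Fin m)) (x : Fin m → ℝ), h (fun j => x (σ j)) = h x

/-- The first `m` observations `(X_1, …, X_m)`, stored as `X 0, …, X (m - 1)`. -/
def firstObs (m : ℕ) (X : ℕ → Ω → ℝ) (ω : Ω) : Fin m → ℝ := fun j => X j ω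

/-- The parameter `θ = ∫ h dF ⋯ dF`, where `F` is the law of `X_1`. -/
def theta (P : Measure Ω) (X : ℕ → Ω → ℝ) {m : ℕ} (h : (Fin m → ℝ) → ℝ) : ℝ :=
  ∫ x, h x ∂(Measure.pi fun _ : Fin m => P.map (X 0))

/-- The projection `h̃₁(x) = E (h(X_1, …, X_m) - θ | X_1 = x)`: the integral of `h - θ` against the
conditional law of `(X_1, …, X_m)` given `X_1 = x`. -/
def proj (P : Measure Ω) [IsFiniteMeasure P] (X : ℕ → Ω → ℝ) {m : ℕ}
    (h : (Fin m → ℝ) → ℝ) (x : ℝ) : ℝ :=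
  ∫ v, (h v - theta P X h) ∂(condDistrib (firstObs m X) (X 0) P x)

/-- `[n]^{-k} = (n - k)! / n!`, used for `k ≤ n`. -/
def invFalling (n k : ℕ) : ℝ := ((n - k)! : ℝ) / (n ! : ℝ)

/-- Positions of `i_1, i_2, …, i_m` in `(i_1, …, i_{2m-1})`. -/
def leftPos (m : ℕ) (j : Fin m) : Fin (2 * m - 1) := ⟨j, by omega⟩

/-- Positions of `i_1, i_{m+1}, …, i_{2m-1}` in `(i_1, …, i_{2m-1})`. -/
def rightPos (m : ℕ) (j : Fin m) : Fin (2 * m - 1) :=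
  ⟨if (j : ℕ) = 0 then 0 else m - 1 + j, by split_ifs <;> omega⟩

/-- The statistic `[n]^{-2m+1} ∑ h(X_{i_1}, X_{i_2}, …, X_{i_m}) h(X_{i_1}, X_{i_{m+1}}, …,
X_{i_{2m-1}})`, the sum being over all `(2m-1)`-tuples of pairwise distinct indices among `n`. -/
def crossStat (X : ℕ → Ω → ℝ) {m : ℕ} (h : (Fin m → ℝ) → ℝ) (n : ℕ) (ω : Ω) : ℝ :=
  invFalling n (2 * m - 1) *
    ∑ i : Fin (2 * m - 1) ↪ Fin n,
      h (fun j => X (i (leftPos m j)) ω) * h (fun j => X (i (rightPos m j)) ω)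

end UStat

end

open scoped ENNReal Topology

/-! Group the sum in `crossStat` by its first index. With n = N + 1 and m = k + 1 it becomes the
mean over a of `pairMean` for the section u = h(X_a, ·) in the other N observations. This is a
U-statistic with kernel u(v)u(w), and its conditional mean given X_a is the square of `sectionMean`
at X_a, almost surely h̃₁(X_a)² (`proj_ae_eq`). It remains to show that the mean of the centred
terms, `centredStat`, is small.

Let p lie in [1, 2]. Hoeffding's representation writes `pairMean` as an average over permutations of
products of two independent means, each over L disjoint blocks. The von Bahr–Esseen inequality puts
such a mean within O(L^(1/p-1)) ‖u‖_p of ∫ u in L^p. By independence the product of two means still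
has p moments, so `pairMean` is within O(L^(1/p-1)) ‖u‖_p² of (∫ u)².

The squared norm dictates a moment of order p/2: (‖u‖_p²)^(p/2) = ∫ |u|^p, which integrates over X_a
to E|h|^p. Since t ↦ t^(p/2) is subadditive, the n dependent terms can simply be added, and
E|`centredStat`|^(p/2) ≤ C n^(1-p/2) L^((1-p)/2) E|h|^p. With L of order n the total exponent is 3/2
- p; for p = 5/3 the bound is of order n^(-1/6). -/

namespace UStat

/-! ### The von Bahr–Esseen inequality. -/

section MomentInequality

/-- A second order expansion of `t ↦ |t| ^ p` around `1`, for exponents between one and two. -/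
lemma abs_one_add_rpow_le {p : ℝ} (hp1 : 1 ≤ p) (hp2 : p ≤ 2) (t : ℝ) :
    |1 + t| ^ p ≤ 1 + p * t + 3 * |t| ^ p := by
  have hp0 : 0 < p := by linarith
  -- The constant 3 is dictated by t ≤ -1: one |t|^p bounds the left side, the other two absorb p *
  -- |t| ≤ 2 * |t|^p.
  rcases le_total t (-1) with ht | ht
  · have h1 : |1 + t| ^ p ≤ |t| ^ p := by
      apply Real.rpow_le_rpow (abs_nonneg _) _ hp0.le
      rw [abs_of_nonpos (by linarith), abs_of_nonpos (by linarith)]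
      linarith
    have h2 : |t| ≤ |t| ^ p :=
      Real.self_le_rpow_of_one_le (by rw [abs_of_nonpos (by linarith)]; linarith) hp1
    have h3 : |t| = -t := abs_of_nonpos (by linarith)
    nlinarith
  · have h0 : 0 ≤ 1 + t := by linarith
    rw [abs_of_nonneg h0]
    have hfac : (1 + t) ^ p = (1 + t) * (1 + t) ^ (p - 1) := by
      rcases h0.eq_or_lt with h | h
      · rw [← h, Real.zero_rpow hp0.ne', zero_mul]
      · rw [← Real.rpow_one_add' h.le (by linarith)]
        ring_nf
    rcases le_or_gt |t| 1 with h1 | h1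
    · have hb : (1 + t) ^ (p - 1) ≤ 1 + (p - 1) * t :=
        rpow_one_add_le_one_add_mul_self ht (by linarith) (by linarith)
      have ht2 : t ^ 2 ≤ |t| ^ p := by
        have := Real.rpow_le_rpow_of_exponent_ge' (abs_nonneg t) h1 hp0.le hp2
        rwa [Real.rpow_two, sq_abs] at this
      rw [hfac]
      nlinarith [mul_le_mul_of_nonneg_left hb h0, sq_nonneg t]
    · have ht1 : 1 ≤ t := by
        rcases lt_abs.1 h1 with h | h <;> linarith
      have ht0 : 0 ≤ t := by linarith
      rw [abs_of_nonneg ht0, hfac]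
      have hs : (1 + t) ^ (p - 1) ≤ 1 + t ^ (p - 1) := by
        have := Real.rpow_add_le_add_rpow zero_le_one ht0 (by linarith : 0 ≤ p - 1) (by linarith)
        simpa using this
      have hm : t ^ (p - 1) ≤ t ^ p := Real.rpow_le_rpow_of_exponent_le ht1 (by linarith)
      have hf : t ^ p = t * t ^ (p - 1) := by
        rw [← Real.rpow_one_add' ht0 (by linarith)]
        ring_nf
      have : 1 ≤ t ^ p := Real.one_le_rpow ht1 hp0.le
      nlinarith [mul_le_mul_of_nonneg_left hs h0]

/-- A second order expansion of `|a + b| ^ p` in `b`, for exponents between one and two. -/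
lemma abs_add_rpow_le {p : ℝ} (hp1 : 1 ≤ p) (hp2 : p ≤ 2) (a b : ℝ) :
    |a + b| ^ p ≤ |a| ^ p + p * (SignType.sign a * |a| ^ (p - 1)) * b + 3 * |b| ^ p := by
  have hp0 : 0 < p := by linarith
  rcases eq_or_ne a 0 with rfl | ha
  · simp only [zero_add, abs_zero, Real.zero_rpow hp0.ne', sign_zero]
    have := Real.rpow_nonneg (abs_nonneg b) p
    simp
    linarith
  · have ha' : 0 < |a| := abs_pos.2 ha
    have h := mul_le_mul_of_nonneg_left (abs_one_add_rpow_le hp1 hp2 (b / a))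
      (Real.rpow_nonneg ha'.le p)
    have e1 : |a| ^ p * |1 + b / a| ^ p = |a + b| ^ p := by
      rw [← Real.mul_rpow ha'.le (abs_nonneg _), ← abs_mul]
      congr 2
      field_simp
    have e2 : |a| ^ p * |b / a| ^ p = |b| ^ p := by
      rw [← Real.mul_rpow ha'.le (abs_nonneg _), ← abs_mul]
      congr 2
      field_simp
    have e3 : |a| ^ p * (b / a) = SignType.sign a * |a| ^ (p - 1) * b := by
      rw [Real.rpow_sub_one ha'.ne']
      rcases ha.lt_or_gt with h | h
      · simp only [sign_neg h, abs_of_neg h]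
        simp only [SignType.coe_neg_one]
        field_simp
      · simp only [sign_pos h, abs_of_pos h]
        simp only [SignType.coe_one]
        field_simp
    calc |a + b| ^ p = |a| ^ p * |1 + b / a| ^ p := e1.symm
      _ ≤ _ := h
      _ = |a| ^ p + p * (|a| ^ p * (b / a)) + 3 * (|a| ^ p * |b / a| ^ p) := by ring
      _ = _ := by rw [e2, e3]; ring

variable {Ω : Type*} [MeasurableSpace Ω] {P : Measure Ω}

lemma measurable_signed_rpow (q : ℝ) :
    Measurable fun a : ℝ => (SignType.sign a : ℝ) * |a| ^ q := by
  have : Measurable fun a : ℝ => (SignType.sign a : ℝ) := by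
    have h : (fun a : ℝ => (SignType.sign a : ℝ))
        = fun a => if 0 < a then 1 else if a < 0 then -1 else 0 := by
      ext a
      rw [sign_apply]
      split_ifs <;> simp
    rw [h]
    exact Measurable.ite measurableSet_Ioi measurable_const
      (Measurable.ite measurableSet_Iio measurable_const measurable_const)
  fun_prop

/-- The inductive step of the von Bahr–Esseen inequality. -/
lemma integral_abs_add_rpow_le [IsProbabilityMeasure P] {p : ℝ} (hp1 : 1 ≤ p) (hp2 : p ≤ 2)
    {S Y : Ω → ℝ} (hS : MemLp S (ENNReal.ofReal p) P) (hY : MemLp Y (ENNReal.ofReal p) P)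
    (hSY : IndepFun S Y P) (hY0 : ∫ ω, Y ω ∂P = 0) :
    ∫ ω, |S ω + Y ω| ^ p ∂P ≤ ∫ ω, |S ω| ^ p ∂P + 3 * ∫ ω, |Y ω| ^ p ∂P := by
  have hp0 : 0 < p := by linarith
  have hpe : ENNReal.ofReal p ≠ 0 := by simpa using hp0
  have hint : ∀ {Z : Ω → ℝ}, MemLp Z (ENNReal.ofReal p) P →
      Integrable (fun ω => |Z ω| ^ p) P := fun {Z} hZ => by
    have := hZ.integrable_norm_rpow hpe ENNReal.ofReal_ne_top
    simpa [ENNReal.toReal_ofReal hp0.le] using this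
  have hYi : Integrable Y P := hY.integrable (by simpa using hp1)
  set g : ℝ → ℝ := fun a => (SignType.sign a : ℝ) * |a| ^ (p - 1) with hg
  have hgm : Measurable g := measurable_signed_rpow _
  have hgi : Integrable (fun ω => g (S ω)) P := by
    refine ((integrable_const (1 : ℝ)).add (hint hS)).mono'
      (hgm.comp_aemeasurable hS.1.aemeasurable).aestronglyMeasurable (ae_of_all _ fun ω => ?_)
    have h1 : ‖g (S ω)‖ ≤ |S ω| ^ (p - 1) := by
      rw [hg, norm_mul, Real.norm_eq_abs, Real.norm_eq_abs,
        abs_of_nonneg (Real.rpow_nonneg (abs_nonneg _) _)]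
      refine mul_le_of_le_one_left (Real.rpow_nonneg (abs_nonneg _) _) ?_
      rcases lt_trichotomy (S ω) 0 with h | h | h <;> simp [h]
    refine h1.trans ?_
    simp only [Pi.add_apply]
    rcases le_total |S ω| 1 with h | h
    · have := Real.rpow_le_one (abs_nonneg _) h (by linarith : 0 ≤ p - 1)
      have := Real.rpow_nonneg (abs_nonneg (S ω)) p
      linarith
    · have := Real.rpow_le_rpow_of_exponent_le h (by linarith : p - 1 ≤ p)
      linarith
  have hind : IndepFun (fun ω => g (S ω)) Y P := hSY.comp hgm measurable_id
  have hgY : Integrable (fun ω => g (S ω) * Y ω) P := hind.integrable_mul hgi hYi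
  -- Independence and the zero mean of Y kill the first-order term of the expansion.
  have hz : ∫ ω, g (S ω) * Y ω ∂P = 0 := by
    rw [hind.integral_fun_mul_eq_mul_integral hgi.1 hYi.1, hY0, mul_zero]
  calc ∫ ω, |S ω + Y ω| ^ p ∂P
      ≤ ∫ ω, (|S ω| ^ p + p * (g (S ω) * Y ω) + 3 * |Y ω| ^ p) ∂P := by
        refine integral_mono (hint (hS.add hY))
          (((hint hS).add (hgY.const_mul p)).add ((hint hY).const_mul 3)) fun ω => ?_
        have := abs_add_rpow_le hp1 hp2 (S ω) (Y ω)
        simp only [hg]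
        linarith
    _ = _ := by
        rw [integral_add (by exact (hint hS).add (hgY.const_mul p)) ((hint hY).const_mul 3),
          integral_add (hint hS) (hgY.const_mul p), integral_const_mul, integral_const_mul, hz]
        ring

/-- The von Bahr–Esseen inequality, with constant `3`. -/
lemma integral_abs_sum_rpow_le [IsProbabilityMeasure P] {p : ℝ} (hp1 : 1 ≤ p) (hp2 : p ≤ 2)
    {ι : Type*} {Y : ι → Ω → ℝ} (hm : ∀ i, Measurable (Y i))
    (hY : ∀ i, MemLp (Y i) (ENNReal.ofReal p) P) (hind : iIndepFun Y P)
    (h0 : ∀ i, ∫ ω, Y i ω ∂P = 0) (s : Finset ι) :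
    ∫ ω, |∑ i ∈ s, Y i ω| ^ p ∂P ≤ 3 * ∑ i ∈ s, ∫ ω, |Y i ω| ^ p ∂P := by
  classical
  induction s using Finset.induction_on with
  | empty => simp [Real.zero_rpow (by linarith : p ≠ 0)]
  | insert a s ha ih =>
    have h := integral_abs_add_rpow_le hp1 hp2 (memLp_finsetSum' s fun i _ => hY i) (hY a)
      (hind.indepFun_finsetSum_of_notMem hm ha) (h0 a)
    simp only [Finset.sum_apply] at h
    simp_rw [Finset.sum_insert ha, add_comm (Y a _)]
    linarith

end MomentInequality

/-! ### Permutation averages, independent blocks, and products of block means. -/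

section Averages

/-- The bijection between the two ranges extends to the whole finite set. This transitivity
underlies Hoeffding's representation. -/
lemma exists_perm_trans_eq {κ α : Type*} [Finite α] (e f : κ ↪ α) :
    ∃ τ : Equiv.Perm α, e.trans τ.toEmbedding = f := by
  classical
  have := Fintype.ofFinite α
  let g : {x // x ∈ Set.range e} ≃ {x // x ∈ Set.range f} :=
    (Equiv.ofInjective e e.injective).symm.trans (Equiv.ofInjective f f.injective)
  refine ⟨g.extendSubtype, ?_⟩
  ext x
  have h := g.extendSubtype_apply_of_mem (e x) ⟨x, rfl⟩
  have h2 : (Equiv.ofInjective e e.injective).symm ⟨e x, x, rfl⟩ = x := by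
    rw [Equiv.symm_apply_eq]
    rfl
  simp only [Function.Embedding.trans_apply, Equiv.coe_toEmbedding]
  rw [h]
  simp [g, h2]

/-- Averaging over embeddings is averaging over the permutations of one embedding. -/
lemma card_mul_sum_embedding {κ α : Type*} [Fintype κ] [Fintype α] [DecidableEq κ]
    [DecidableEq α] (G : (κ ↪ α) → ℝ) (e : κ ↪ α) :
    (Fintype.card (Equiv.Perm α) : ℝ) * ∑ f, G f
      = (Fintype.card (κ ↪ α) : ℝ) * ∑ σ : Equiv.Perm α, G (e.trans σ.toEmbedding) := by
  -- Double counting over pairs (σ, f): the sum over f does not depend on σ, and by transitivity the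
  -- sum over σ does not depend on f.
  have h1 : ∀ σ : Equiv.Perm α, ∑ f : κ ↪ α, G (f.trans σ.toEmbedding) = ∑ f, G f := fun σ =>
    Fintype.sum_equiv (Equiv.embeddingCongr (Equiv.refl κ) σ) _ _ fun f => by
      congr 1
  have h2 : ∀ f : κ ↪ α, ∑ σ : Equiv.Perm α, G (f.trans σ.toEmbedding)
      = ∑ σ : Equiv.Perm α, G (e.trans σ.toEmbedding) := fun f => by
    obtain ⟨τ, rfl⟩ := exists_perm_trans_eq e f
    exact Fintype.sum_equiv (Equiv.mulRight τ) _ _ fun σ => by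
      congr 1
  calc _ = ∑ σ : Equiv.Perm α, ∑ f : κ ↪ α, G (f.trans σ.toEmbedding) := by
        simp [h1]
    _ = ∑ f : κ ↪ α, ∑ σ : Equiv.Perm α, G (f.trans σ.toEmbedding) := Finset.sum_comm
    _ = _ := by simp [h2]

/-- Under a product measure, families of disjoint blocks of coordinates are independent. -/
lemma measurePreserving_blocks {ι β κ : Type*} [Fintype ι] [Fintype β] [Fintype κ]
    {𝒳 : Type*} [MeasurableSpace 𝒳] (μ : Measure 𝒳) [IsProbabilityMeasure μ] (e : β × κ ↪ ι) :
    MeasurePreserving (fun (z : ι → 𝒳) (b : β) (j : κ) => z (e (b, j)))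
      (Measure.pi fun _ => μ) (Measure.pi fun _ => Measure.pi fun _ => μ) := by
  have hsel : MeasurePreserving (fun (z : ι → 𝒳) (q : β × κ) => z (e q))
      (Measure.pi fun _ => μ) (Measure.pi fun _ => μ) := by
    refine ⟨by fun_prop, ?_⟩
    have hi : iIndepFun (fun (i : ι) (z : ι → 𝒳) => z i) (Measure.pi fun _ => μ) :=
      iIndepFun_pi (X := fun _ => id) fun _ => aemeasurable_id
    rw [(hi.precomp e.injective).map_fun_eq_pi_map fun q => (measurable_pi_apply _).aemeasurable]
    congr
    ext1 q
    exact (measurePreserving_eval (fun _ : ι => μ) (e q)).map_eq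
  have hunc : Measurable fun (y : β → κ → 𝒳) (q : β × κ) => y q.1 q.2 := by fun_prop
  have hcur : Measurable fun (y : β × κ → 𝒳) (b : β) (j : κ) => y (b, j) := by fun_prop
  -- The flat product is characterised by its values on boxes, so uncurrying is checked there;
  -- currying then follows as its inverse.
  have hflat : (Measure.pi fun _ : β => Measure.pi fun _ : κ => μ).map
      (fun (y : β → κ → 𝒳) (q : β × κ) => y q.1 q.2) = Measure.pi fun _ => μ := by
    refine (Measure.pi_eq fun s hs => ?_).symm
    rw [Measure.map_apply hunc (MeasurableSet.univ_pi hs)]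
    have : (fun (y : β → κ → 𝒳) (q : β × κ) => y q.1 q.2) ⁻¹' Set.univ.pi s
        = Set.univ.pi fun b => Set.univ.pi fun j => s (b, j) := by
      ext y
      simp [Set.mem_pi]
    rw [this]
    simp [Measure.pi_pi, Fintype.prod_prod_type]
  have hcurry : MeasurePreserving (fun (y : β × κ → 𝒳) (b : β) (j : κ) => y (b, j))
      (Measure.pi fun _ => μ) (Measure.pi fun _ => Measure.pi fun _ => μ) := by
    refine ⟨hcur, ?_⟩
    rw [← hflat, Measure.map_map hcur hunc]
    exact Measure.map_id
  exact hcurry.comp hsel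

variable {𝒱 : Type*} [MeasurableSpace 𝒱] {ν : Measure 𝒱} [IsProbabilityMeasure ν]

lemma eLpNorm_ofReal_rpow {Ω : Type*} [MeasurableSpace Ω] {P : Measure Ω} {p : ℝ} (hp : 0 < p)
    {f : Ω → ℝ} (hf : MemLp f (ENNReal.ofReal p) P) :
    ENNReal.ofReal (∫ ω, |f ω| ^ p ∂P) = eLpNorm f (ENNReal.ofReal p) P ^ p := by
  have hpe : ENNReal.ofReal p ≠ 0 := by simpa using hp
  have h := hf.eLpNorm_eq_integral_rpow_norm hpe ENNReal.ofReal_ne_top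
  rw [ENNReal.toReal_ofReal hp.le] at h
  have h0 : 0 ≤ ∫ ω, ‖f ω‖ ^ p ∂P := integral_nonneg fun ω => Real.rpow_nonneg (norm_nonneg _) _
  rw [h, ENNReal.ofReal_rpow_of_nonneg (Real.rpow_nonneg h0 _) hp.le, ← Real.rpow_mul h0,
    inv_mul_cancel₀ hp.ne', Real.rpow_one]
  simp

lemma enorm_integral_le_eLpNorm {u : 𝒱 → ℝ} {q : ℝ≥0∞} (hq : 1 ≤ q)
    (hu : AEStronglyMeasurable u ν) : ‖∫ v, u v ∂ν‖ₑ ≤ eLpNorm u q ν :=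
  calc ‖∫ v, u v ∂ν‖ₑ ≤ ∫⁻ v, ‖u v‖ₑ ∂ν := enorm_integral_le_lintegral_enorm _
    _ = eLpNorm u 1 ν := eLpNorm_one_eq_lintegral_enorm.symm
    _ ≤ eLpNorm u q ν := eLpNorm_le_eLpNorm_of_exponent_le hq hu

/-- `L ^ p` law of large numbers for means of independent copies, for `p` between one and two. -/
lemma eLpNorm_mean_sub_integral_le {p : ℝ} (hp1 : 1 ≤ p) (hp2 : p ≤ 2) {u : 𝒱 → ℝ}
    (hum : Measurable u) (hu : MemLp u (ENNReal.ofReal p) ν) {L : ℕ} (hL : 1 ≤ L) :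
    eLpNorm (fun y : Fin L → 𝒱 => (L : ℝ)⁻¹ * ∑ a, u (y a) - ∫ v, u v ∂ν) (ENNReal.ofReal p)
        (Measure.pi fun _ => ν)
      ≤ ENNReal.ofReal (6 * (L : ℝ) ^ (1 / p - 1)) * eLpNorm u (ENNReal.ofReal p) ν := by
  have hp0 : 0 < p := by linarith
  have hpe : ENNReal.ofReal p ≠ 0 := by simpa using hp0
  have hpe1 : 1 ≤ ENNReal.ofReal p := by simpa using hp1
  have hL0 : (0 : ℝ) < L := by exact_mod_cast hL
  set c := ∫ v, u v ∂ν with hc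
  have hui : Integrable u ν := hu.integrable hpe1
  have hcnorm : eLpNorm (fun _ : 𝒱 => c) (ENNReal.ofReal p) ν ≤ eLpNorm u (ENNReal.ofReal p) ν := by
    rw [eLpNorm_const _ hpe (IsProbabilityMeasure.ne_zero ν)]
    simp only [measure_univ, ENNReal.one_rpow, mul_one]
    exact enorm_integral_le_eLpNorm hpe1 hu.1
  set w : 𝒱 → ℝ := fun v => u v - c with hw
  have hwm : Measurable w := hum.sub_const c
  have hwL : MemLp w (ENNReal.ofReal p) ν := hu.sub (memLp_const c)
  have hwnorm : eLpNorm w (ENNReal.ofReal p) ν ≤ 2 * eLpNorm u (ENNReal.ofReal p) ν := by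
    refine (eLpNorm_sub_le hu.1 aestronglyMeasurable_const hpe1).trans ?_
    rw [two_mul]
    gcongr
  have hev : ∀ a : Fin L, MeasurePreserving (Function.eval a)
      (Measure.pi fun _ : Fin L => ν) ν := fun a => measurePreserving_eval _ a
  have hYL : ∀ a : Fin L, MemLp (fun y : Fin L → 𝒱 => w (y a)) (ENNReal.ofReal p)
      (Measure.pi fun _ => ν) := fun a => hwL.comp_measurePreserving (hev a)
  have hYi : ∀ a : Fin L, ∫ y : Fin L → 𝒱, |w (y a)| ^ p ∂(Measure.pi fun _ => ν)
      = ∫ v, |w v| ^ p ∂ν := fun a =>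
    integral_comp_eval (μ := fun _ : Fin L => ν) (i := a) (f := fun v => |w v| ^ p)
      (hwm.abs.pow_const p).aestronglyMeasurable
  have hY0 : ∀ a : Fin L, ∫ y : Fin L → 𝒱, w (y a) ∂(Measure.pi fun _ => ν) = 0 := fun a => by
    refine (integral_comp_eval (μ := fun _ : Fin L => ν) (i := a) hwm.aestronglyMeasurable).trans ?_
    rw [hw, integral_sub hui (integrable_const c)]
    simp [hc]
  have hsum := integral_abs_sum_rpow_le hp1 hp2 (P := Measure.pi fun _ : Fin L => ν)
    (Y := fun a y => w (y a)) (fun a => by fun_prop) hYL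
    (iIndepFun_pi (X := fun _ => w) fun _ => hwm.aemeasurable) hY0 Finset.univ
  simp only [hYi, Finset.sum_const, Finset.card_univ, Fintype.card_fin, nsmul_eq_mul] at hsum
  have hSL : MemLp (fun y : Fin L → 𝒱 => ∑ a, w (y a)) (ENNReal.ofReal p)
    (Measure.pi fun _ => ν) := memLp_finsetSum _ fun a _ => hYL a
  -- The moment bound has factor 3, weakened to 3^p so that the p-th root is clean. Centring costs
  -- another factor 2, hence the final 6.
  have hSn : eLpNorm (fun y : Fin L → 𝒱 => ∑ a, w (y a)) (ENNReal.ofReal p)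
      (Measure.pi fun _ => ν)
      ≤ ENNReal.ofReal (3 * (L : ℝ) ^ (1 / p)) * eLpNorm w (ENNReal.ofReal p) ν := by
    rw [← ENNReal.rpow_le_rpow_iff hp0, ENNReal.mul_rpow_of_nonneg _ _ hp0.le,
      ← eLpNorm_ofReal_rpow hp0 hSL, ← eLpNorm_ofReal_rpow hp0 hwL,
      ENNReal.ofReal_rpow_of_nonneg (by positivity) hp0.le, ← ENNReal.ofReal_mul (by positivity)]
    refine ENNReal.ofReal_le_ofReal (hsum.trans ?_)
    rw [← mul_assoc]
    refine mul_le_mul_of_nonneg_right ?_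
      (integral_nonneg fun v => Real.rpow_nonneg (abs_nonneg _) _)
    rw [Real.mul_rpow (by norm_num) (by positivity), ← Real.rpow_mul hL0.le,
      one_div_mul_cancel hp0.ne', Real.rpow_one]
    gcongr
    exact Real.self_le_rpow_of_one_le (by norm_num) hp1
  have hfun : (fun y : Fin L → 𝒱 => (L : ℝ)⁻¹ * ∑ a, u (y a) - c)
      = (L : ℝ)⁻¹ • fun y : Fin L → 𝒱 => ∑ a, w (y a) := by
    ext y
    simp only [hw, Pi.smul_apply, smul_eq_mul, Finset.sum_sub_distrib, Finset.sum_const,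
      Finset.card_univ, Fintype.card_fin, nsmul_eq_mul]
    field_simp
  rw [hfun, eLpNorm_const_smul]
  calc _ ≤ ‖(L : ℝ)⁻¹‖ₑ * (ENNReal.ofReal (3 * (L : ℝ) ^ (1 / p))
          * (2 * eLpNorm u (ENNReal.ofReal p) ν)) := by gcongr; exact hSn.trans (by gcongr)
    _ = _ := by
      rw [Real.enorm_of_nonneg (by positivity), ← ENNReal.ofReal_ofNat 2, ← mul_assoc, ← mul_assoc,
        ← ENNReal.ofReal_mul (by positivity), ← ENNReal.ofReal_mul (by positivity),
        Real.rpow_sub_one hL0.ne']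
      congr 2
      field_simp
      norm_num

/-- The product of two independent means is close to the square of the expectation. -/
lemma eLpNorm_mean_mul_mean_sub_sq_le {p : ℝ} (hp1 : 1 ≤ p) (hp2 : p ≤ 2) {u : 𝒱 → ℝ}
    (hum : Measurable u) (hu : MemLp u (ENNReal.ofReal p) ν) {L : ℕ} (hL : 1 ≤ L) :
    eLpNorm (fun y : Fin L ⊕ Fin L → 𝒱 =>
        ((L : ℝ)⁻¹ * ∑ a, u (y (.inl a))) * ((L : ℝ)⁻¹ * ∑ b, u (y (.inr b)))
          - (∫ v, u v ∂ν) ^ 2) (ENNReal.ofReal p) (Measure.pi fun _ => ν)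
      ≤ ENNReal.ofReal (48 * (L : ℝ) ^ (1 / p - 1)) * eLpNorm u (ENNReal.ofReal p) ν ^ 2 := by
  have hp0 : 0 < p := by linarith
  have hpe : ENNReal.ofReal p ≠ 0 := by simpa using hp0
  have hpe1 : 1 ≤ ENNReal.ofReal p := by simpa using hp1
  have hL0 : (0 : ℝ) < L := by exact_mod_cast hL
  set c := ∫ v, u v ∂ν with hc
  set D : (Fin L → 𝒱) → ℝ := fun y => (L : ℝ)⁻¹ * ∑ a, u (y a) - c with hD
  have hDm : Measurable D := by fun_prop
  set B := eLpNorm D (ENNReal.ofReal p) (Measure.pi fun _ => ν) with hB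
  have hBle : B ≤ ENNReal.ofReal (6 * (L : ℝ) ^ (1 / p - 1)) * eLpNorm u (ENNReal.ofReal p) ν :=
    eLpNorm_mean_sub_integral_le hp1 hp2 hum hu hL
  have hcn : ‖c‖ₑ ≤ eLpNorm u (ENNReal.ofReal p) ν :=
    enorm_integral_le_eLpNorm hpe1 hu.1
  have hmp := measurePreserving_sumPiEquivProdPi (X := fun _ : Fin L ⊕ Fin L => 𝒱) (fun _ => ν)
  have h1 : eLpNorm (fun q : (Fin L → 𝒱) × (Fin L → 𝒱) => D q.1) (ENNReal.ofReal p)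
      ((Measure.pi fun _ => ν).prod (Measure.pi fun _ => ν)) = B :=
    eLpNorm_comp_measurePreserving (g := D) hDm.aestronglyMeasurable measurePreserving_fst
  have h2 : eLpNorm (fun q : (Fin L → 𝒱) × (Fin L → 𝒱) => D q.2) (ENNReal.ofReal p)
      ((Measure.pi fun _ => ν).prod (Measure.pi fun _ => ν)) = B :=
    eLpNorm_comp_measurePreserving (g := D) hDm.aestronglyMeasurable measurePreserving_snd
  -- By independence the L^p norm of the product factors, so no moment of order 2p is needed.
  have h12 : eLpNorm (fun q : (Fin L → 𝒱) × (Fin L → 𝒱) => D q.1 * D q.2) (ENNReal.ofReal p)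
      ((Measure.pi fun _ => ν).prod (Measure.pi fun _ => ν)) = B * B := by
    rw [hB, eLpNorm_eq_lintegral_rpow_enorm_toReal hpe ENNReal.ofReal_ne_top,
      eLpNorm_eq_lintegral_rpow_enorm_toReal hpe ENNReal.ofReal_ne_top,
      ENNReal.toReal_ofReal hp0.le, ← ENNReal.mul_rpow_of_nonneg _ _ (by positivity),
      ← lintegral_prod_mul (by fun_prop) (by fun_prop)]
    simp_rw [enorm_mul, ENNReal.mul_rpow_of_nonneg _ _ hp0.le]
  have hQ : (fun y : Fin L ⊕ Fin L → 𝒱 =>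
        ((L : ℝ)⁻¹ * ∑ a, u (y (.inl a))) * ((L : ℝ)⁻¹ * ∑ b, u (y (.inr b))) - c ^ 2)
      = (fun q : (Fin L → 𝒱) × (Fin L → 𝒱) => D q.1 * D q.2 + (c * D q.1 + c * D q.2))
        ∘ MeasurableEquiv.sumPiEquivProdPi (fun _ : Fin L ⊕ Fin L => 𝒱) := by
    ext y
    simp only [hD, Function.comp_apply, MeasurableEquiv.coe_sumPiEquivProdPi,
      Equiv.sumPiEquivProdPi_apply]
    ring
  rw [hQ, eLpNorm_comp_measurePreserving (by fun_prop) hmp]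
  have hcD1 : eLpNorm (fun q : (Fin L → 𝒱) × (Fin L → 𝒱) => c * D q.1) (ENNReal.ofReal p)
      ((Measure.pi fun _ => ν).prod (Measure.pi fun _ => ν)) = ‖c‖ₑ * B := by
    rw [← h1]
    exact eLpNorm_const_smul c _ _ _
  have hcD2 : eLpNorm (fun q : (Fin L → 𝒱) × (Fin L → 𝒱) => c * D q.2) (ENNReal.ofReal p)
      ((Measure.pi fun _ => ν).prod (Measure.pi fun _ => ν)) = ‖c‖ₑ * B := by
    rw [← h2]
    exact eLpNorm_const_smul c _ _ _
  set W := eLpNorm u (ENNReal.ofReal p) ν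
  set r : ℝ := (L : ℝ) ^ (1 / p - 1) with hr
  have hr0 : 0 ≤ r := by positivity
  have hr1 : r ≤ 1 := by
    refine Real.rpow_le_one_of_one_le_of_nonpos (by exact_mod_cast hL) ?_
    have : 1 / p ≤ 1 := by rw [div_le_one hp0]; exact hp1
    linarith
  calc _ ≤ B * B + (‖c‖ₑ * B + ‖c‖ₑ * B) := by
        rw [← h12, ← hcD1]
        nth_rewrite 2 [hcD1]
        rw [← hcD2]
        refine (eLpNorm_add_le (by fun_prop) (by fun_prop) hpe1).trans ?_
        gcongr
        exact eLpNorm_add_le ((hDm.comp measurable_fst).const_mul c).aestronglyMeasurable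
          ((hDm.comp measurable_snd).const_mul c).aestronglyMeasurable hpe1
    _ ≤ (ENNReal.ofReal (6 * r) * W) * (ENNReal.ofReal (6 * r) * W)
        + (W * (ENNReal.ofReal (6 * r) * W) + W * (ENNReal.ofReal (6 * r) * W)) := by gcongr
    _ = ENNReal.ofReal (36 * r ^ 2 + 12 * r) * W ^ 2 := by
        rw [show 36 * r ^ 2 + 12 * r = (6 * r) * (6 * r) + (6 * r + 6 * r) by ring,
          ENNReal.ofReal_add (by positivity) (by positivity),
          ENNReal.ofReal_add (by positivity) (by positivity),
          ENNReal.ofReal_mul (p := 6 * r) (q := 6 * r) (by positivity)]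
        ring
    -- As 0 ≤ r ≤ 1, r² ≤ r, and 36 + 12 = 48.
    _ ≤ _ := by
        gcongr
        nlinarith

end Averages

/-! ### Hoeffding's representation and moment bounds for `pairMean`. -/

section PairMean

/-- The average of `u (z ∘ f₁) * u (z ∘ f₂)` over all pairs of embeddings `f₁`, `f₂` with disjoint
ranges. -/
noncomputable def pairMean {κ α : Type*} [Fintype κ] [Fintype α] [DecidableEq κ] [DecidableEq α]
    (u : (κ → ℝ) → ℝ) (z : α → ℝ) : ℝ :=
  (Fintype.card (κ ⊕ κ ↪ α) : ℝ)⁻¹ *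
    ∑ f : κ ⊕ κ ↪ α, u (fun j => z (f (.inl j))) * u (fun j => z (f (.inr j)))

variable {κ α : Type*} [Fintype κ] [Fintype α] [DecidableEq κ] [DecidableEq α]

/-- Hoeffding's representation of `pairMean` as an average over permutations of products of means
over disjoint blocks. -/
lemma pairMean_eq_sum_perm (u : (κ → ℝ) → ℝ) {L : ℕ} (hL : 1 ≤ L)
    (e : (Fin L ⊕ Fin L) × κ ↪ α) (z : α → ℝ) :
    pairMean u z = (Fintype.card (Equiv.Perm α) : ℝ)⁻¹ * ∑ σ : Equiv.Perm α,
      ((L : ℝ)⁻¹ * ∑ a, u (fun j => z (σ (e (.inl a, j)))))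
        * ((L : ℝ)⁻¹ * ∑ b, u (fun j => z (σ (e (.inr b, j))))) := by
  have hL0 : (L : ℝ) ≠ 0 := by positivity
  let ε (a b : Fin L) : κ ⊕ κ ↪ α :=
    ⟨Sum.elim (fun j => e (.inl a, j)) (fun j => e (.inr b, j)), by
      rintro (i | i) (j | j) hij <;> simp at hij <;> simp [hij]⟩
  have hcard : (Fintype.card (κ ⊕ κ ↪ α) : ℝ) ≠ 0 := by
    have : Nonempty (κ ⊕ κ ↪ α) := ⟨ε ⟨0, hL⟩ ⟨0, hL⟩⟩
    exact_mod_cast Fintype.card_ne_zero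
  have hperm : (Fintype.card (Equiv.Perm α) : ℝ) ≠ 0 := by exact_mod_cast Fintype.card_ne_zero
  -- Any left block a and right block b serve as base embedding; averaging over all L² choices makes
  -- the summand a product of two means.
  have hab : ∀ a b, pairMean u z = (Fintype.card (Equiv.Perm α) : ℝ)⁻¹ * ∑ σ : Equiv.Perm α,
      u (fun j => z (σ (e (.inl a, j)))) * u (fun j => z (σ (e (.inr b, j)))) := fun a b => by
    have h := card_mul_sum_embedding
      (fun f : κ ⊕ κ ↪ α => u (fun j => z (f (.inl j))) * u (fun j => z (f (.inr j)))) (ε a b)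
    simp only [Function.Embedding.trans_apply, Equiv.coe_toEmbedding] at h
    change _ = _ * ∑ σ : Equiv.Perm α,
      u (fun j => z (σ (e (.inl a, j)))) * u (fun j => z (σ (e (.inr b, j)))) at h
    rw [pairMean, inv_mul_eq_iff_eq_mul₀ hcard, mul_left_comm, ← h, inv_mul_cancel_left₀ hperm]
  calc pairMean u z = (L : ℝ)⁻¹ * ∑ _a : Fin L, (L : ℝ)⁻¹ * ∑ _b : Fin L, pairMean u z := by
        simp [hL0]
    _ = (L : ℝ)⁻¹ * ∑ a : Fin L, (L : ℝ)⁻¹ * ∑ b : Fin L,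
        (Fintype.card (Equiv.Perm α) : ℝ)⁻¹ * ∑ σ : Equiv.Perm α,
          u (fun j => z (σ (e (.inl a, j)))) * u (fun j => z (σ (e (.inr b, j)))) := by
        congr 1
        refine Finset.sum_congr rfl fun a _ => ?_
        congr 1
        exact Finset.sum_congr rfl fun b _ => hab a b
    _ = _ := by
        simp only [Finset.mul_sum, Finset.sum_mul]
        simp_rw [fun a : Fin L => Finset.sum_comm (s := (Finset.univ : Finset (Fin L)))
          (t := (Finset.univ : Finset (Equiv.Perm α)))
          (f := fun b σ => (L : ℝ)⁻¹ * ((L : ℝ)⁻¹ * ((Fintype.card (Equiv.Perm α) : ℝ)⁻¹ *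
          (u (fun j => z (σ (e (.inl a, j)))) * u (fun j => z (σ (e (.inr b, j))))))))]
        rw [Finset.sum_comm]
        refine Finset.sum_congr rfl fun σ _ => ?_
        rw [Finset.sum_comm]
        refine Finset.sum_congr rfl fun b _ => Finset.sum_congr rfl fun a _ => ?_
        ring

lemma measurable_pairMean {u : (κ → ℝ) → ℝ} (hu : Measurable u) :
    Measurable (pairMean u : (α → ℝ) → ℝ) := by
  unfold pairMean
  fun_prop

/-- The `L ^ p` distance between `pairMean u` and the squared expectation of `u`. -/
lemma eLpNorm_pairMean_sub_sq_le (μ : Measure ℝ) [IsProbabilityMeasure μ] {p : ℝ} (hp1 : 1 ≤ p)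
    (hp2 : p ≤ 2) {u : (κ → ℝ) → ℝ} (hum : Measurable u) {L : ℕ} (hL : 1 ≤ L)
    (hcard : 2 * L * Fintype.card κ ≤ Fintype.card α) :
    eLpNorm (fun z : α → ℝ => pairMean u z - (∫ v, u v ∂(Measure.pi fun _ => μ)) ^ 2)
        (ENNReal.ofReal p) (Measure.pi fun _ => μ)
      ≤ ENNReal.ofReal (48 * (L : ℝ) ^ (1 / p - 1))
        * eLpNorm u (ENNReal.ofReal p) (Measure.pi fun _ => μ) ^ 2 := by
  have hL0 : (0 : ℝ) < L := by exact_mod_cast hL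
  -- Sections of h need be p-integrable only for almost every head, so infinite norms are admitted:
  -- the right side is then ∞.
  rcases eq_or_ne (eLpNorm u (ENNReal.ofReal p) (Measure.pi fun _ => μ)) ∞ with htop | htop
  · rw [htop, ENNReal.top_pow two_ne_zero, ENNReal.mul_top]
    · exact le_top
    · rw [Ne, ENNReal.ofReal_eq_zero, not_le]
      positivity
  have hu : MemLp u (ENNReal.ofReal p) (Measure.pi fun _ => μ) :=
    ⟨hum.aestronglyMeasurable, htop.lt_top⟩
  obtain ⟨e⟩ : Nonempty ((Fin L ⊕ Fin L) × κ ↪ α) :=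
    Function.Embedding.nonempty_of_card_le (by simpa [two_mul] using hcard)
  set c := ∫ v, u v ∂(Measure.pi fun _ => μ)
  set Q : (Fin L ⊕ Fin L → κ → ℝ) → ℝ := fun y =>
    ((L : ℝ)⁻¹ * ∑ a, u (y (.inl a))) * ((L : ℝ)⁻¹ * ∑ b, u (y (.inr b))) - c ^ 2 with hQ
  have hQm : Measurable Q := by fun_prop
  have hperm : (Fintype.card (Equiv.Perm α) : ℝ) ≠ 0 := by exact_mod_cast Fintype.card_ne_zero
  have hrep : (fun z : α → ℝ => pairMean u z - c ^ 2)
      = (Fintype.card (Equiv.Perm α) : ℝ)⁻¹ • ∑ σ : Equiv.Perm α,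
        Q ∘ fun z b j => z ((e.trans σ.toEmbedding) (b, j)) := by
    ext z
    simp only [Pi.smul_apply, Finset.sum_apply, smul_eq_mul, Function.comp_apply, hQ,
      Finset.sum_sub_distrib, mul_sub, Finset.sum_const, Finset.card_univ, nsmul_eq_mul,
      inv_mul_cancel_left₀ hperm, Function.Embedding.trans_apply, Equiv.coe_toEmbedding]
    rw [pairMean_eq_sum_perm u hL e z]
  -- Every permuted term has the same law, so after the triangle inequality the average costs no
  -- more than a single term.
  have hle : eLpNorm (∑ σ : Equiv.Perm α, Q ∘ fun z b j => z ((e.trans σ.toEmbedding) (b, j)))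
        (ENNReal.ofReal p) (Measure.pi fun _ => μ)
      ≤ Fintype.card (Equiv.Perm α) * eLpNorm Q (ENNReal.ofReal p)
        (Measure.pi fun _ => Measure.pi fun _ => μ) := by
    refine (eLpNorm_sum_le (fun σ _ => ?_) (by simpa using hp1)).trans_eq ?_
    · exact (hQm.comp (measurePreserving_blocks μ _).measurable).aestronglyMeasurable
    · simp_rw [fun σ : Equiv.Perm α => eLpNorm_comp_measurePreserving (p := ENNReal.ofReal p)
        hQm.aestronglyMeasurable (measurePreserving_blocks μ (e.trans σ.toEmbedding))]
      simp
  rw [hrep, eLpNorm_const_smul]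
  calc _ ≤ ‖(Fintype.card (Equiv.Perm α) : ℝ)⁻¹‖ₑ * (Fintype.card (Equiv.Perm α)
        * eLpNorm Q (ENNReal.ofReal p) (Measure.pi fun _ => Measure.pi fun _ => μ)) := by gcongr
    _ = eLpNorm Q (ENNReal.ofReal p) (Measure.pi fun _ => Measure.pi fun _ => μ) := by
        rw [enorm_inv hperm, ← mul_assoc, Real.enorm_natCast,
          ENNReal.inv_mul_cancel, one_mul]
        · exact_mod_cast Fintype.card_ne_zero
        · exact ENNReal.natCast_ne_top _
    _ ≤ _ := eLpNorm_mean_mul_mean_sub_sq_le hp1 hp2 hum hu hL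

lemma eLpNorm_ofReal_rpow_eq_lintegral {β : Type*} [MeasurableSpace β] {ρ : Measure β} {q : ℝ}
    (hq : 0 < q) {f : β → ℝ} : eLpNorm f (ENNReal.ofReal q) ρ ^ q = ∫⁻ x, ‖f x‖ₑ ^ q ∂ρ := by
  rw [eLpNorm_eq_lintegral_rpow_enorm_toReal (by simpa using hq) ENNReal.ofReal_ne_top,
    ENNReal.toReal_ofReal hq.le, ← ENNReal.rpow_mul, one_div_mul_cancel hq.ne', ENNReal.rpow_one]

/-- The moment of order `p / 2` of `pairMean u` minus the squared expectation of `u`. -/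
lemma lintegral_pairMean_sub_sq_le (μ : Measure ℝ) [IsProbabilityMeasure μ] {p : ℝ} (hp1 : 1 ≤ p)
    (hp2 : p ≤ 2) {u : (κ → ℝ) → ℝ} (hum : Measurable u) {L : ℕ} (hL : 1 ≤ L)
    (hcard : 2 * L * Fintype.card κ ≤ Fintype.card α) :
    ∫⁻ z : α → ℝ, ‖pairMean u z - (∫ v, u v ∂(Measure.pi fun _ => μ)) ^ 2‖ₑ ^ (p / 2)
        ∂(Measure.pi fun _ => μ)
      ≤ ENNReal.ofReal (48 * (L : ℝ) ^ (1 / p - 1)) ^ (p / 2)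
        * ∫⁻ v, ‖u v‖ₑ ^ p ∂(Measure.pi fun _ => μ) := by
  have hp0 : 0 < p := by linarith
  rw [← eLpNorm_ofReal_rpow_eq_lintegral (half_pos hp0), ← eLpNorm_ofReal_rpow_eq_lintegral hp0]
  -- Norms on a probability space increase with the exponent, so the L^p bound passes to order p/2,
  -- where the squared norm of u becomes ∫ |u|^p.
  calc _ ≤ (ENNReal.ofReal (48 * (L : ℝ) ^ (1 / p - 1))
          * eLpNorm u (ENNReal.ofReal p) (Measure.pi fun _ => μ) ^ 2) ^ (p / 2) := by
        gcongr
        refine le_trans (eLpNorm_le_eLpNorm_of_exponent_le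
          (ENNReal.ofReal_le_ofReal (by linarith)) ?_)
          (eLpNorm_pairMean_sub_sq_le μ hp1 hp2 hum hL hcard)
        exact ((measurable_pairMean hum).sub_const _).aestronglyMeasurable
    _ = _ := by
        rw [ENNReal.mul_rpow_of_nonneg _ _ (half_pos hp0).le, ← ENNReal.rpow_two,
          ← ENNReal.rpow_mul]
        congr 2
        ring

end PairMean

/-! ### Splitting off the common index of the tuple. -/

section Embeddings

/-- Adjoin a point `a` to an embedding into the complement of `a`. -/
def consEmbedding {κ : Type*} {N : ℕ} (a : Fin (N + 1)) (f : κ ↪ Fin N) :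
    Option κ ↪ Fin (N + 1) :=
  (f.trans a.succAboveEmb).optionElim a (by simp [Fin.succAbove_ne])

lemma sum_embedding_option {κ : Type*} [Fintype κ] [DecidableEq κ] {N : ℕ}
    (G : (Option κ ↪ Fin (N + 1)) → ℝ) :
    ∑ f, G f = ∑ a : Fin (N + 1), ∑ f : κ ↪ Fin N, G (consEmbedding a f) := by
  rw [← Fintype.sum_prod_type']
  refine (Fintype.sum_bijective (fun q : Fin (N + 1) × (κ ↪ Fin N) => consEmbedding q.1 q.2) ?_ _ _
    fun _ => rfl).symm
  -- Surjectivity comes from counting, by the recursion for falling factorials.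
  refine (Fintype.bijective_iff_injective_and_card _).2 ⟨?_, ?_⟩
  · rintro ⟨a, f⟩ ⟨b, g⟩ h
    obtain rfl : a = b := DFunLike.congr_fun h none
    have hfg : f = g := by
      ext1 j
      exact Fin.succAbove_right_injective (DFunLike.congr_fun h (some j))
    rw [hfg]
  · simp only [Fintype.card_prod, Fintype.card_embedding_eq, Fintype.card_option, Fintype.card_fin,
      Nat.succ_descFactorial_succ]

/-- Positions of a tuple consisting of a head and two blocks of length `k`. -/
noncomputable def positionEquiv (k : ℕ) : Option (Fin k ⊕ Fin k) ≃ Fin (2 * (k + 1) - 1) :=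
  Equiv.ofBijective
    (fun o => o.elim ⟨0, by omega⟩
      (Sum.elim (fun j => ⟨j + 1, by omega⟩) fun j => ⟨k + 1 + j, by omega⟩)) <| by
    refine (Fintype.bijective_iff_injective_and_card _).2 ⟨?_, ?_⟩
    · rintro (_ | i | i) (_ | j | j) h <;> simp [Fin.ext_iff] at h ⊢ <;> omega
    · simp
      omega

/-- The head position followed by the positions `s`. -/
def headThen {k : ℕ} (s : Fin k → Fin k ⊕ Fin k) : Fin (k + 1) → Option (Fin k ⊕ Fin k) :=
  Fin.cons none fun i => some (s i)

lemma leftPos_eq (k : ℕ) (j : Fin (k + 1)) :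
    leftPos (k + 1) j = positionEquiv k (headThen Sum.inl j) := by
  refine Fin.cases ?_ (fun i => ?_) j
  · rfl
  · simp [headThen, leftPos, positionEquiv]

lemma rightPos_eq (k : ℕ) (j : Fin (k + 1)) :
    rightPos (k + 1) j = positionEquiv k (headThen Sum.inr j) := by
  refine Fin.cases ?_ (fun i => ?_) j
  · rfl
  · simp [headThen, rightPos, positionEquiv]
    omega

lemma invFalling_eq {n k : ℕ} (hk : k ≤ n) : invFalling n k = (n.descFactorial k : ℝ)⁻¹ := by
  have h : ((n - k)! : ℝ) * n.descFactorial k = n ! := by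
    exact_mod_cast Nat.factorial_mul_descFactorial hk
  have h1 : (n.descFactorial k : ℝ) ≠ 0 := by
    exact_mod_cast (Nat.descFactorial_pos.2 hk).ne'
  rw [invFalling, ← h]
  field_simp

/-- `crossStat` as a mean of `pairMean`s of the sections of the kernel. -/
lemma crossStat_eq {Ω : Type*} [MeasurableSpace Ω] (X : ℕ → Ω → ℝ) {k N : ℕ}
    (h : (Fin (k + 1) → ℝ) → ℝ) (hk : 2 * k ≤ N) (ω : Ω) :
    crossStat X h (N + 1) ω = ((N + 1 : ℕ) : ℝ)⁻¹ * ∑ a : Fin (N + 1),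
      pairMean (fun v : Fin k → ℝ => h (Fin.cons (X a ω) v))
        (fun j : Fin N => X (a.succAbove j) ω) := by
  have hcons : ∀ (a : Fin (N + 1)) (f : Fin k ⊕ Fin k ↪ Fin N) (s : Fin k → Fin k ⊕ Fin k),
      (fun j : Fin (k + 1) => X (consEmbedding a f (headThen s j)) ω)
      = Fin.cons (X a ω) fun i => X (a.succAbove (f (s i))) ω := fun a f s => by
    ext j
    refine Fin.cases ?_ (fun i => ?_) j <;> simp [consEmbedding, headThen]
  have hinv : invFalling (N + 1) (2 * (k + 1) - 1)
      = ((N + 1 : ℕ) : ℝ)⁻¹ * (N.descFactorial (2 * k) : ℝ)⁻¹ := by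
    rw [invFalling_eq (by omega), show 2 * (k + 1) - 1 = 2 * k + 1 by omega,
      Nat.succ_descFactorial_succ, Nat.cast_mul, mul_inv]
  have hsum : ∑ i : Fin (2 * (k + 1) - 1) ↪ Fin (N + 1),
        h (fun j => X (i (leftPos (k + 1) j)) ω) * h (fun j => X (i (rightPos (k + 1) j)) ω)
      = ∑ i : Option (Fin k ⊕ Fin k) ↪ Fin (N + 1),
        h (fun j => X (i (headThen Sum.inl j)) ω)
          * h (fun j => X (i (headThen Sum.inr j)) ω) := by
    refine Fintype.sum_equiv (Equiv.embeddingCongr (positionEquiv k).symm (Equiv.refl _)) _ _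
      fun i => ?_
    simp only [leftPos_eq, rightPos_eq]
    rfl
  rw [crossStat, hinv, hsum, sum_embedding_option, mul_assoc, Finset.mul_sum]
  simp_rw [hcons, pairMean]
  simp [Fintype.card_embedding_eq, two_mul]

end Embeddings

/-! ### The moment of order p/2 of the centred statistic. -/

section Moments

lemma measurable_fin_cons {k : ℕ} :
    Measurable fun q : ℝ × (Fin k → ℝ) => (Fin.cons q.1 q.2 : Fin (k + 1) → ℝ) := by
  refine measurable_pi_lambda _ fun j => ?_
  refine Fin.cases ?_ (fun i => ?_) j
  · simpa using measurable_fst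
  · simpa using (by fun_prop : Measurable fun q : ℝ × (Fin k → ℝ) => q.2 i)

lemma measurable_fin_cons_right {k : ℕ} (x : ℝ) :
    Measurable fun v : Fin k → ℝ => (Fin.cons x v : Fin (k + 1) → ℝ) :=
  measurable_fin_cons.comp measurable_prodMk_left

/-- Subadditivity of t ↦ t^q replaces the triangle inequality, which fails for L^q with q < 1. -/
lemma enorm_sum_rpow_le {ι : Type*} (s : Finset ι) (f : ι → ℝ) {q : ℝ} (hq0 : 0 < q)
    (hq1 : q ≤ 1) : ‖∑ i ∈ s, f i‖ₑ ^ q ≤ ∑ i ∈ s, ‖f i‖ₑ ^ q := by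
  classical
  induction s using Finset.induction_on with
  | empty => simp [hq0]
  | insert a s ha ih =>
    rw [Finset.sum_insert ha, Finset.sum_insert ha]
    calc _ ≤ (‖f a‖ₑ + ‖∑ i ∈ s, f i‖ₑ) ^ q := by
          gcongr
          exact enorm_add_le _ _
      _ ≤ ‖f a‖ₑ ^ q + ‖∑ i ∈ s, f i‖ₑ ^ q := ENNReal.rpow_add_le_add_rpow _ _ hq0.le hq1
      _ ≤ _ := by gcongr

/-- The conditional expectation of the kernel given that its first argument is `x`. -/
noncomputable def sectionMean {k : ℕ} (μ : Measure ℝ) (h : (Fin (k + 1) → ℝ) → ℝ) (x : ℝ) : ℝ :=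
  ∫ v : Fin k → ℝ, h (Fin.cons x v) ∂(Measure.pi fun _ => μ)

/-- The mean over `a` of the centred statistics `pairMean` of the section of `h` at the `a`-th
observation. -/
noncomputable def centredStat {k N : ℕ} (μ : Measure ℝ) (h : (Fin (k + 1) → ℝ) → ℝ)
    (y : Fin (N + 1) → ℝ) : ℝ :=
  ((N + 1 : ℕ) : ℝ)⁻¹ * ∑ a : Fin (N + 1),
    (pairMean (fun v : Fin k → ℝ => h (Fin.cons (y a) v)) (fun j : Fin N => y (a.succAbove j))
      - sectionMean μ h (y a) ^ 2)

variable {k N : ℕ} {h : (Fin (k + 1) → ℝ) → ℝ}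

lemma measurable_sectionMean (μ : Measure ℝ) [IsProbabilityMeasure μ] (hh : Measurable h) :
    Measurable (sectionMean μ h) :=
  (StronglyMeasurable.integral_prod_right'
    (hh.comp measurable_fin_cons).stronglyMeasurable).measurable

lemma measurable_pairMean_section (hh : Measurable h) :
    Measurable fun q : ℝ × (Fin N → ℝ) =>
      pairMean (fun v : Fin k → ℝ => h (Fin.cons q.1 v)) q.2 := by
  unfold pairMean
  refine measurable_const.mul (Finset.measurable_sum _ fun f _ => Measurable.mul ?_ ?_)
  · exact hh.comp (measurable_fin_cons.comp (by fun_prop :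
      Measurable fun q : ℝ × (Fin N → ℝ) => (q.1, fun j => q.2 (f (.inl j)))))
  · exact hh.comp (measurable_fin_cons.comp (by fun_prop :
      Measurable fun q : ℝ × (Fin N → ℝ) => (q.1, fun j => q.2 (f (.inr j)))))

lemma measurable_centredStat (μ : Measure ℝ) [IsProbabilityMeasure μ] (hh : Measurable h) :
    Measurable (centredStat μ h : (Fin (N + 1) → ℝ) → ℝ) := by
  unfold centredStat
  refine measurable_const.mul (Finset.measurable_sum _ fun a _ => Measurable.sub ?_ ?_)
  · have hsel : Measurable fun y : Fin (N + 1) → ℝ => (y a, fun j : Fin N => y (a.succAbove j)) := by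
      fun_prop
    have := (measurable_pairMean_section (N := N) hh).comp hsel
    exact this
  · exact ((measurable_sectionMean μ hh).comp (measurable_pi_apply a)).pow_const 2

lemma lintegral_pi_succAbove (μ : Measure ℝ) [IsProbabilityMeasure μ] (a : Fin (N + 1))
    {G : ℝ × (Fin N → ℝ) → ℝ≥0∞} (hG : Measurable G) :
    ∫⁻ y : Fin (N + 1) → ℝ, G (y a, fun j => y (a.succAbove j)) ∂(Measure.pi fun _ => μ)
      = ∫⁻ x, ∫⁻ z, G (x, z) ∂(Measure.pi fun _ => μ) ∂μ := by
  rw [← lintegral_prod _ hG.aemeasurable]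
  exact (measurePreserving_piFinSuccAbove (fun _ : Fin (N + 1) => μ) a).lintegral_comp hG

/-- The factor (N+1)^(1-p/2) comes from N+1 terms, each weighted by (N+1)^(-p/2). Each term is
bounded with its head fixed and then integrated over the head; their mutual dependence is
irrelevant. -/
lemma lintegral_centredStat_le (μ : Measure ℝ) [IsProbabilityMeasure μ] {p : ℝ} (hp1 : 1 ≤ p)
    (hp2 : p ≤ 2) (hh : Measurable h) {L : ℕ} (hL : 1 ≤ L) (hLN : 2 * L * k ≤ N) :
    ∫⁻ y : Fin (N + 1) → ℝ, ‖centredStat μ h y‖ₑ ^ (p / 2) ∂(Measure.pi fun _ => μ)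
      ≤ ENNReal.ofReal (((N + 1 : ℕ) : ℝ) ^ (1 - p / 2) * (48 * (L : ℝ) ^ (1 / p - 1)) ^ (p / 2))
        * ∫⁻ v, ‖h v‖ₑ ^ p ∂(Measure.pi fun _ => μ) := by
  have hp0 : 0 < p := by linarith
  have hL0 : (0 : ℝ) < L := by exact_mod_cast hL
  set K := ENNReal.ofReal (48 * (L : ℝ) ^ (1 / p - 1)) ^ (p / 2) with hK
  set I := ∫⁻ v, ‖h v‖ₑ ^ p ∂(Measure.pi fun _ => μ) with hI
  set G : ℝ × (Fin N → ℝ) → ℝ≥0∞ := fun q =>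
    ‖pairMean (fun v : Fin k → ℝ => h (Fin.cons q.1 v)) q.2 - sectionMean μ h q.1 ^ 2‖ₑ ^ (p / 2)
    with hG
  have hGm : Measurable G :=
    (((measurable_pairMean_section hh).sub
      (((measurable_sectionMean μ hh).comp measurable_fst).pow_const 2)).enorm).pow_const _
  have hI' : I = ∫⁻ x, ∫⁻ v : Fin k → ℝ, ‖h (Fin.cons x v)‖ₑ ^ p ∂(Measure.pi fun _ => μ) ∂μ := by
    rw [← lintegral_pi_succAbove μ (0 : Fin (k + 1))
      (G := fun q => ‖h (Fin.cons q.1 q.2)‖ₑ ^ p)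
      ((hh.comp measurable_fin_cons).enorm.pow_const _)]
    refine lintegral_congr fun y => ?_
    congr 3
    exact (Fin.cons_self_tail y).symm
  have hterm : ∀ a : Fin (N + 1),
      ∫⁻ y : Fin (N + 1) → ℝ, G (y a, fun j => y (a.succAbove j)) ∂(Measure.pi fun _ => μ)
        ≤ K * I := fun a => by
    rw [lintegral_pi_succAbove μ a hGm, hI', ← lintegral_const_mul' _ _ (by
      exact ENNReal.rpow_ne_top_of_nonneg (by positivity) ENNReal.ofReal_ne_top)]
    refine lintegral_mono fun x => ?_
    exact lintegral_pairMean_sub_sq_le μ hp1 hp2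
      (u := fun v : Fin k → ℝ => h (Fin.cons x v))
      (hh.comp (measurable_fin_cons_right x)) hL (by simpa using hLN)
  have hN0 : (0 : ℝ) < (N + 1 : ℕ) := by positivity
  calc _ ≤ ∫⁻ y : Fin (N + 1) → ℝ, ‖((N + 1 : ℕ) : ℝ)⁻¹‖ₑ ^ (p / 2)
          * ∑ a : Fin (N + 1), G (y a, fun j => y (a.succAbove j)) ∂(Measure.pi fun _ => μ) := by
        refine lintegral_mono fun y => ?_
        simp only [centredStat, enorm_mul]
        rw [ENNReal.mul_rpow_of_nonneg _ _ (half_pos hp0).le]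
        gcongr
        exact enorm_sum_rpow_le _ _ (half_pos hp0) (by linarith)
    _ = ‖((N + 1 : ℕ) : ℝ)⁻¹‖ₑ ^ (p / 2) * ∑ a : Fin (N + 1),
          ∫⁻ y : Fin (N + 1) → ℝ, G (y a, fun j => y (a.succAbove j)) ∂(Measure.pi fun _ => μ) := by
        have hm : ∀ a : Fin (N + 1),
            Measurable fun y : Fin (N + 1) → ℝ => G (y a, fun j => y (a.succAbove j)) :=
          fun a => hGm.comp (by fun_prop)
        rw [lintegral_const_mul _ (Finset.measurable_sum _ fun a _ => hm a),
          lintegral_finsetSum _ fun a _ => hm a]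
    _ ≤ ‖((N + 1 : ℕ) : ℝ)⁻¹‖ₑ ^ (p / 2) * ∑ _a : Fin (N + 1), K * I := by
        gcongr with a _
        exact hterm a
    _ = _ := by
        rw [Finset.sum_const, Finset.card_univ, Fintype.card_fin, nsmul_eq_mul, hK,
          Real.enorm_of_nonneg (by positivity),
          ENNReal.ofReal_rpow_of_nonneg (by positivity) (by positivity),
          ENNReal.ofReal_rpow_of_nonneg (by positivity) (by positivity),
          ← ENNReal.ofReal_natCast (N + 1), ← mul_assoc, ← mul_assoc,
          ← ENNReal.ofReal_mul (by positivity), ← ENNReal.ofReal_mul (by positivity),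
          Real.inv_rpow hN0.le, Real.rpow_sub hN0, Real.rpow_one]
        congr 2
        ring

end Moments

/-! ### Identifying the projection with the section mean. -/

section Projection

variable {Ω : Type*} [MeasurableSpace Ω] {P : Measure Ω} {X : ℕ → Ω → ℝ}

lemma map_firstObs (hX_meas : ∀ i, Measurable (X i)) (hX_indep : iIndepFun X P)
    (hX_ident : ∀ i, IdentDistrib (X i) (X 0) P P) (n : ℕ) :
    P.map (firstObs n X) = Measure.pi fun _ => P.map (X 0) := by
  have h := iIndepFun.map_fun_eq_pi_map (f := fun j : Fin n => X j)
    (fun j => (hX_meas j).aemeasurable) (hX_indep.precomp Fin.val_injective)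
  refine h.trans ?_
  congr
  ext1 j
  exact (hX_ident j).map_eq

/-- The projection of a centred kernel is, almost everywhere, the mean of its sections. -/
lemma proj_ae_eq [IsProbabilityMeasure P] (hX_meas : ∀ i, Measurable (X i)) (hX_indep : iIndepFun X P)
    (hX_ident : ∀ i, IdentDistrib (X i) (X 0) P P) {k : ℕ} {h : (Fin (k + 1) → ℝ) → ℝ}
    (hh : Measurable h) (hθ : theta P X h = 0) :
    proj P X h =ᵐ[P.map (X 0)] sectionMean (P.map (X 0)) h := by
  have hprob : IsProbabilityMeasure (P.map (X 0)) :=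
    Measure.isProbabilityMeasure_map (hX_meas 0).aemeasurable
  set μ := P.map (X 0)
  set ν : Measure (Fin k → ℝ) := Measure.pi fun _ => μ
  have hobs : Measurable (firstObs (k + 1) X) := measurable_pi_lambda _ fun j => hX_meas j
  -- Candidate conditional law: keep the head x and draw the other k coordinates from ν. Uniqueness
  -- of the disintegration identifies it almost everywhere.
  let κ : Kernel ℝ (Fin (k + 1) → ℝ) :=
    (Kernel.id ×ₖ Kernel.const ℝ ν).map fun q : ℝ × (Fin k → ℝ) => (Fin.cons q.1 q.2 : _ → ℝ)
  have hκ : ∀ x, κ x = ν.map fun v => (Fin.cons x v : Fin (k + 1) → ℝ) := fun x => by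
    rw [Kernel.map_apply _ measurable_fin_cons, Kernel.prod_apply, Kernel.id_apply,
      Kernel.const_apply, Measure.dirac_prod, Measure.map_map measurable_fin_cons (by fun_prop)]
    rfl
  have hfin : IsMarkovKernel κ := Kernel.IsMarkovKernel.map _ measurable_fin_cons
  have hlaw : P.map (fun ω => (X 0 ω, firstObs (k + 1) X ω)) = μ ⊗ₘ κ := by
    have h1 : P.map (fun ω => (X 0 ω, firstObs (k + 1) X ω))
        = (Measure.pi fun _ : Fin (k + 1) => μ).map fun y => (y 0, y) := by
      rw [← map_firstObs hX_meas hX_indep hX_ident, Measure.map_map (by fun_prop) hobs]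
      rfl
    have h2 : (Measure.pi fun _ : Fin (k + 1) => μ)
        = (μ.prod ν).map fun q => (Fin.cons q.1 q.2 : Fin (k + 1) → ℝ) := by
      refine ((measurePreserving_piFinSuccAbove (fun _ : Fin (k + 1) => μ) 0).symm).map_eq.symm.trans ?_
      simp [MeasurableEquiv.piFinSuccAbove_symm_apply, Fin.insertNthEquiv, ν]
    rw [h1, h2, Measure.map_map (by fun_prop) measurable_fin_cons]
    ext s hs
    rw [Measure.map_apply (by
      exact ((measurable_pi_apply 0).prodMk measurable_id).comp measurable_fin_cons) hs,
      Measure.prod_apply (by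
      exact (((measurable_pi_apply 0).prodMk measurable_id).comp measurable_fin_cons) hs),
      Measure.compProd_apply hs]
    refine lintegral_congr fun x => ?_
    rw [hκ, Measure.map_apply (measurable_fin_cons_right x)
      (measurable_prodMk_left hs)]
    rfl
  filter_upwards [condDistrib_ae_eq_of_measure_eq_compProd (X 0) hobs.aemeasurable hlaw] with x hx
  rw [proj, hx, hθ, hκ, integral_map
    (measurable_fin_cons_right x).aemeasurable
    (hh.sub_const 0).aestronglyMeasurable]
  simp [sectionMean, ν]

end Projection

/-! ### The rate at p = 5/3 and the conclusion. -/

/-- The exponents are 1/6 and -1/3, with sum -1/6. Dividing by 2(k+1) rather than 2k keeps the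
number of blocks meaningful for k = 0. -/
lemma tendsto_rate (k : ℕ) :
    Tendsto (fun N : ℕ => ((N + 1 : ℕ) : ℝ) ^ (1 - (5 / 3 : ℝ) / 2)
      * (48 * ((N / (2 * (k + 1)) : ℕ) : ℝ) ^ (1 / (5 / 3 : ℝ) - 1)) ^ ((5 / 3 : ℝ) / 2))
      atTop (𝓝 0) := by
  have hL : Tendsto (fun N : ℕ => ((N / (2 * (k + 1)) : ℕ) : ℝ)) atTop atTop :=
    tendsto_natCast_atTop_atTop.comp (Nat.tendsto_div_const_atTop (by omega))
  have hlim : Tendsto (fun N : ℕ => ((4 * (k + 1) : ℝ) ^ (1 / 6 : ℝ) * 48 ^ (5 / 6 : ℝ))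
      * ((N / (2 * (k + 1)) : ℕ) : ℝ) ^ (-(1 / 6 : ℝ))) atTop (𝓝 0) := by
    have := ((tendsto_rpow_neg_atTop (by norm_num : (0 : ℝ) < 1 / 6)).comp hL).const_mul
      ((4 * (k + 1) : ℝ) ^ (1 / 6 : ℝ) * 48 ^ (5 / 6 : ℝ))
    simpa using this
  refine squeeze_zero' (Eventually.of_forall fun N => by positivity) ?_ hlim
  filter_upwards [eventually_ge_atTop (2 * (k + 1))] with N hN
  set L := N / (2 * (k + 1)) with hLdef
  have hL1 : 1 ≤ L := (Nat.one_le_div_iff (by omega)).2 hN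
  have hL0 : (0 : ℝ) < L := by exact_mod_cast hL1
  -- N + 1 ≤ 2(k+1)(L+1), and L + 1 ≤ 2L.
  have hNL : ((N + 1 : ℕ) : ℝ) ≤ (4 * (k + 1)) * L := by
    have h1 : N < 2 * (k + 1) * (L + 1) := Nat.lt_mul_div_succ N (by omega)
    have h2 : N + 1 ≤ 4 * (k + 1) * L := by nlinarith
    exact_mod_cast h2
  calc _ ≤ ((4 * (k + 1)) * (L : ℝ)) ^ (1 - (5 / 3 : ℝ) / 2)
        * (48 * (L : ℝ) ^ (1 / (5 / 3 : ℝ) - 1)) ^ ((5 / 3 : ℝ) / 2) := by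
        gcongr
    _ = _ := by
        rw [Real.mul_rpow (x := 4 * (k + 1)) (by positivity) (by positivity),
          Real.mul_rpow (x := 48) (by positivity) (by positivity), ← Real.rpow_mul hL0.le,
          show -(1 / 6 : ℝ) = (1 - (5 / 3 : ℝ) / 2) + (1 / (5 / 3 : ℝ) - 1) * ((5 / 3 : ℝ) / 2) by
            norm_num, Real.rpow_add hL0]
        norm_num
        ring

lemma centredStat_firstObs {Ω : Type*} [MeasurableSpace Ω] (X : ℕ → Ω → ℝ) (μ : Measure ℝ)
    {k N : ℕ} (h : (Fin (k + 1) → ℝ) → ℝ) (hk : 2 * k ≤ N) (ω : Ω) :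
    centredStat μ h (firstObs (N + 1) X ω) = crossStat X h (N + 1) ω
      - (1 / ((N + 1 : ℕ) : ℝ)) * ∑ i ∈ Finset.range (N + 1), sectionMean μ h (X i ω) ^ 2 := by
  rw [crossStat_eq X h hk, centredStat, Finset.sum_sub_distrib, mul_sub, one_div,
    Finset.sum_range fun i => sectionMean μ h (X i ω) ^ 2]
  rfl

lemma tendstoInMeasure_centredStat {Ω : Type*} [MeasurableSpace Ω] {P : Measure Ω}
    [IsProbabilityMeasure P] {X : ℕ → Ω → ℝ} (hX_meas : ∀ i, Measurable (X i))
    (hX_indep : iIndepFun X P) (hX_ident : ∀ i, IdentDistrib (X i) (X 0) P P) {k : ℕ}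
    {h : (Fin (k + 1) → ℝ) → ℝ} (hh : Measurable h)
    (hmoment : Integrable (fun ω => |h (firstObs (k + 1) X ω)| ^ (5 / 3 : ℝ)) P) :
    TendstoInMeasure P
      (fun (N : ℕ) ω => |centredStat (P.map (X 0)) h (firstObs (N + 1) X ω)|)
      atTop (fun _ => (0 : ℝ)) := by
  have hprob : IsProbabilityMeasure (P.map (X 0)) :=
    Measure.isProbabilityMeasure_map (hX_meas 0).aemeasurable
  set μ := P.map (X 0)
  have hobs : ∀ n, Measurable (firstObs n X) := fun n => measurable_pi_lambda _ fun j => hX_meas j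
  have hlaw : ∀ (n : ℕ) {G : (Fin n → ℝ) → ℝ≥0∞}, Measurable G →
      ∫⁻ ω, G (firstObs n X ω) ∂P = ∫⁻ y, G y ∂(Measure.pi fun _ => μ) := fun n G hG => by
    rw [← map_firstObs hX_meas hX_indep hX_ident, lintegral_map hG (hobs n)]
  have hfin : ∫⁻ v, ‖h v‖ₑ ^ (5 / 3 : ℝ) ∂(Measure.pi fun _ => μ) ≠ ∞ := by
    rw [← hlaw (k + 1) (hh.enorm.pow_const _)]
    refine ne_of_lt ?_
    convert hmoment.2 using 1
    rw [hasFiniteIntegral_iff_enorm]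
    congr! 3 with ω
    rw [Real.enorm_of_nonneg (Real.rpow_nonneg (abs_nonneg _) _), Real.enorm_eq_ofReal_abs,
      ENNReal.ofReal_rpow_of_nonneg (abs_nonneg _) (by norm_num)]
  have hlim : Tendsto (fun N : ℕ => ∫⁻ ω,
      ‖centredStat μ h (firstObs (N + 1) X ω)‖ₑ ^ ((5 / 3 : ℝ) / 2) ∂P) atTop (𝓝 0) := by
    have hbound := ENNReal.Tendsto.mul_const
      (ENNReal.tendsto_ofReal (tendsto_rate k)) (b := ∫⁻ v, ‖h v‖ₑ ^ (5 / 3 : ℝ)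
        ∂(Measure.pi fun _ => μ)) (Or.inr hfin)
    rw [ENNReal.ofReal_zero, zero_mul] at hbound
    refine tendsto_of_tendsto_of_tendsto_of_le_of_le' tendsto_const_nhds hbound
      (Eventually.of_forall fun _ => zero_le) ?_
    filter_upwards [eventually_ge_atTop (2 * (k + 1))] with N hN
    rw [hlaw (N + 1) (G := fun y => ‖centredStat μ h y‖ₑ ^ ((5 / 3 : ℝ) / 2))
      ((measurable_centredStat μ hh).enorm.pow_const _)]
    refine lintegral_centredStat_le μ (by norm_num) (by norm_num) hh
      ((Nat.one_le_div_iff (by omega)).2 hN) ?_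
    have := Nat.div_mul_le_self N (2 * (k + 1))
    nlinarith
  -- Markov's inequality needs only a positive exponent, so 5/6 < 1 is admissible.
  refine tendstoInMeasure_of_tendsto_eLpNorm (p := ENNReal.ofReal ((5 / 3 : ℝ) / 2)) (by norm_num)
    (fun N => ((measurable_centredStat μ hh).comp (hobs _)).abs.aestronglyMeasurable)
    aestronglyMeasurable_const ?_
  have hroot := hlim.ennrpow_const ((5 / 3 : ℝ) / 2)⁻¹
  rw [ENNReal.zero_rpow_of_pos (by norm_num)] at hroot
  refine hroot.congr fun N => ?_
  rw [← eLpNorm_ofReal_rpow_eq_lintegral (by norm_num), ← ENNReal.rpow_mul,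
    mul_inv_cancel₀ (by norm_num), ENNReal.rpow_one]
  refine eLpNorm_congr_norm_ae (ae_of_all _ fun ω => ?_)
  simp

end UStat

theorem theorem2 {Ω : Type*} [MeasurableSpace Ω] (P : Measure Ω) [IsProbabilityMeasure P]
    (X : ℕ → Ω → ℝ) (hX_meas : ∀ i, Measurable (X i)) (hX_indep : iIndepFun X P)
    (hX_ident : ∀ i, IdentDistrib (X i) (X 0) P P)
    (m : ℕ) (hm : 1 ≤ m) (h : (Fin m → ℝ) → ℝ) (hh_meas : Measurable h)
    (hh_symm : UStat.IsSymmKernel h)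
    (hh_moment : Integrable (fun ω => |h (UStat.firstObs m X ω)| ^ (5 / 3 : ℝ)) P)
    (hθ : UStat.theta P X h = 0)
    (hDAN : UStat.IsDAN P (fun i ω => UStat.proj P X h (X i ω))) :
    TendstoInMeasure P
      (fun (n : ℕ) (ω : Ω) =>
        |UStat.crossStat X h n ω
          - (1 / (n : ℝ)) * ∑ i ∈ Finset.range n, (UStat.proj P X h (X i ω)) ^ 2|)
      atTop (fun _ => (0 : ℝ)) := by
  obtain ⟨k, rfl⟩ : ∃ k, m = k + 1 := ⟨m - 1, by omega⟩
  have hproj : ∀ i, ∀ᵐ ω ∂P, UStat.proj P X h (X i ω)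
      = UStat.sectionMean (P.map (X 0)) h (X i ω) := fun i => by
    have h0 := UStat.proj_ae_eq hX_meas hX_indep hX_ident hh_meas hθ
    -- Hiding the section mean lets the next rewrite replace the law of X 0 by that of X i only in
    -- the almost-everywhere filter.
    generalize UStat.sectionMean (P.map (X 0)) h = c at h0 ⊢
    rw [← (hX_ident i).map_eq] at h0
    exact ae_of_ae_map (hX_meas i).aemeasurable h0
  have hshift := (UStat.tendstoInMeasure_centredStat hX_meas hX_indep hX_ident hh_meas
    hh_moment).congr' (f' := fun (N : ℕ) ω => |UStat.crossStat X h (N + 1) ω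
          - (1 / ((N + 1 : ℕ) : ℝ)) * ∑ i ∈ Finset.range (N + 1),
            (UStat.proj P X h (X i ω)) ^ 2|) (by
      filter_upwards [eventually_ge_atTop (2 * k)] with N hN
      filter_upwards [ae_all_iff.2 hproj] with ω hω
      rw [UStat.centredStat_firstObs X _ h hN]
      simp only [hω]) EventuallyEq.rfl
  -- The estimates concern n = N + 1; shifting the index does not affect the limit.
  intro ε hε
  exact (tendsto_add_atTop_iff_nat 1).1 (hshift ε hε)
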